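/- **Proposition 4.1 (non-generic Adinkras).** For $N\ge 2$, an $N$-colored Adinkra $\mathcal{A}$ is a finite, simple, connected graph $G$ in which every edge carries a sign in $\{\pm 1\}$ and one of $N$ colors, such that: (1) $G$ is bipartite; (2) every vertex is incident to exactly one edge of each color; (3) for every two distinct colors, the spanning subgraph formed by the edges of these two colors is a disjoint union of $4$-cycles; (4) each such bi-colored $4$-cycle contains an odd number of negative edges. Let $v$ be the number of vertices of $G$, and define $m$ by requiring that the rank over $\mathbb{F}_2$ of the ordinary (unsigned) Laplacian of $G$ be $v/2-m$; call $\mathcal{A}$ non-generic if $m>0$. Let $L(\mathcal{A})=D-A_\sigma$ be the signed Laplacian, where $D$ is the diagonal matrix of vertex degrees and $A_\sigma$ is the adjacency matrix in which each edge is represented by its sign. Fix an arbitrary color $c$, and let $\hat L(\mathcal{A})$ be the matrix over $\mathbb{Z}[x]$ obtained from $L(\mathcal{A})$ by replacing every diagonal entry by $x+(N-1)$ and by multiplying by $x$ every off-diagonal entry $\pm1$ that corresponds to an edge of color $c$. If $\mathcal{A}$ is non-generic, then $\hat L(\mathcal{A})$ has no Smith normal form over $\mathbb{Z}[x]$: there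 are no invertible matrices $P,Q\in GL_v(\mathbb{Z}[x])$ such that $P\,\hat L(\mathcal{A})\,Q=\operatorname{diag}(\hat f_1,\dots,\hat f_v)$ with $\hat f_1\mid \hat f_2\mid\cdots\mid \hat f_v$. -/

import Mathlib

open Polynomial

/-- A simple graph on `V` with a sign on each edge (`-1` is a negative edge) and a color, one of
`N`, on each edge. -/
structure SignedColoredGraph (N : ℕ) (V : Type*) where
  /-- the underlying graph -/
  graph : SimpleGraph V
  /-- the signature -/
  sign : graph.edgeSet → ℤˣ
  /-- the edge coloring -/
  color : graph.edgeSet → Fin N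

namespace SignedColoredGraph

variable {N : ℕ} {V : Type*}

/-- The spanning subgraph consisting of the edges of color `c` or `d`. -/
def bicolored (S : SignedColoredGraph N V) (c d : Fin N) : SimpleGraph V where
  Adj u v := ∃ h : S.graph.Adj u v, S.color ⟨s(u, v), h⟩ = c ∨ S.color ⟨s(u, v), h⟩ = d
  symm := ⟨by
    rintro u v ⟨h, hc⟩
    refine ⟨h.symm, ?_⟩
    have e : (⟨s(v, u), h.symm⟩ : S.graph.edgeSet) = ⟨s(u, v), h⟩ := Subtype.ext Sym2.eq_swap
    rwa [e]⟩
  loopless := ⟨fun v h => h.1.ne rfl⟩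

end SignedColoredGraph

/-- An `N`-colored Adinkra on the vertex set `V` (without a choice of orientation, which plays no
role for the Laplacian). -/
structure Adinkra (N : ℕ) (V : Type*) extends SignedColoredGraph N V where
  two_le : 2 ≤ N
  connected : graph.Connected
  bipartite : graph.IsBipartite
  /-- every vertex is incident to exactly one edge of each color -/
  existsUnique_edge : ∀ (v : V) (c : Fin N), ∃! e : graph.edgeSet, v ∈ e.val ∧ color e = c
  /-- for distinct colors, the bicolored subgraph is a disjoint union of `4`-cycles -/
  bicolored_component : ∀ c d : Fin N, c ≠ d →
    ∀ K : (toSignedColoredGraph.bicolored c d).ConnectedComponent,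
      Nonempty (K.toSimpleGraph ≃g SimpleGraph.cycleGraph 4)
  /-- every bicolored `4`-cycle `w x y z` has an odd number of negative edges -/
  odd_negative : ∀ c d : Fin N, c ≠ d → ∀ w x y z : V, w ≠ y → x ≠ z →
    ∀ (hwx : (toSignedColoredGraph.bicolored c d).Adj w x)
      (hxy : (toSignedColoredGraph.bicolored c d).Adj x y)
      (hyz : (toSignedColoredGraph.bicolored c d).Adj y z)
      (hzw : (toSignedColoredGraph.bicolored c d).Adj z w),
      Odd ([sign ⟨s(w, x), hwx.1⟩, sign ⟨s(x, y), hxy.1⟩,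
        sign ⟨s(y, z), hyz.1⟩, sign ⟨s(z, w), hzw.1⟩].count (-1))

namespace Adinkra

variable {N : ℕ} {V : Type*} [Fintype V] [DecidableEq V]

open scoped Classical in
/-- The signed adjacency matrix `A_σ`. -/
noncomputable def signedAdjMatrix (A : Adinkra N V) : Matrix V V ℤ :=
  Matrix.of fun u v => if h : A.graph.Adj u v then (A.sign ⟨s(u, v), h⟩ : ℤ) else 0

open scoped Classical in
/-- The signed Laplacian `L(𝒜) = D - A_σ`. -/
noncomputable def laplacian (A : Adinkra N V) : Matrix V V ℤ :=
  Matrix.diagonal (fun v => (A.graph.degree v : ℤ)) - A.signedAdjMatrix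

open scoped Classical in
/-- The deformed Laplacian `L̂(𝒜)` over `ℤ[x]` for the color `c`: the diagonal entries of `L(𝒜)`
become `x + (N - 1)`, and the entries `±1` at edges of color `c` become `±x`. -/
noncomputable def deformedLaplacian (A : Adinkra N V) (c : Fin N) : Matrix V V ℤ[X] :=
  Matrix.of fun u v =>
    if u = v then X + ((N : ℤ[X]) - 1)
    else if ∃ h : A.graph.Adj u v, A.color ⟨s(u, v), h⟩ = c then C (A.laplacian u v) * X
    else C (A.laplacian u v)

open scoped Classical in
/-- The rank over `𝔽₂` of the Laplacian of the underlying (unsigned) graph. -/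
noncomputable def twoRank (A : Adinkra N V) : ℕ :=
  (A.graph.lapMatrix (ZMod 2)).rank

/-- The number `m` for which the `2`-rank is `v / 2 - m`, where `v` is the number of vertices. -/
noncomputable def twoRankDefect (A : Adinkra N V) : ℚ :=
  (Fintype.card V : ℚ) / 2 - A.twoRank

/-- An Adinkra is non-generic if `m > 0`. -/
def IsNonGeneric (A : Adinkra N V) : Prop :=
  0 < A.twoRankDefect

end Adinkra

/-- The square matrix `M` over the commutative ring `R` has a Smith normal form: there are
invertible matrices `P`, `Q` over `R` with `P M Q` diagonal and with diagonal entries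
`f₁ ∣ f₂ ∣ ⋯ ∣ fᵥ` (along some enumeration `e` of the index set). -/
def HasSmithNormalForm {R ι : Type*} [CommRing R] [Fintype ι] [DecidableEq ι]
    (M : Matrix ι ι R) : Prop :=
  ∃ (P Q : Matrix.GeneralLinearGroup ι R) (e : ι ≃ Fin (Fintype.card ι))
    (f : Fin (Fintype.card ι) → R),
    (∀ i j, i ≤ j → f i ∣ f j) ∧
      (P : Matrix ι ι R) * M * (Q : Matrix ι ι R) = Matrix.diagonal fun i => f (e i)

/-!
If `P M Q = diag(f₁, …, fᵥ)` with `f₁ ∣ f₂ ∣ ⋯`, then under any ring homomorphism to a field the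
factor `f_{r+1}` vanishes exactly when the image of `M` has rank at most `r`. Modulo `2` and at
`x = 1` the deformed Laplacian becomes the unsigned Laplacian, of rank `r < v / 2` for a
non-generic Adinkra, whereas over `𝔽₂(x)` its rank is at least `v / 2`: each half of the
bipartition gives a block `(x + N - 1) • 1`. Hence `f_{r+1}` vanishes modulo `2` at `x = 1` without
vanishing modulo `2`, so it is not constant and has a complex root. But the deformed Laplacian has
rank at least `v / 2` at every complex number: this is again seen on the two blocks, except at
`x = 1 - N`, where the Clifford relations between the colors make the matrix invertible.
-/

section General

theorem sum_mul_self_of_pairwise_anticomm {ι R : Type*} [NonUnitalNonAssocSemiring R]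
    (s : Finset ι) (a : ι → R)
    (h : (s : Set ι).Pairwise fun i j => a i * a j + a j * a i = 0) :
    (∑ i ∈ s, a i) * ∑ i ∈ s, a i = ∑ i ∈ s, a i * a i := by
  classical
  induction s using Finset.induction_on with
  | empty => simp
  | insert i s hi ih =>
    rw [Finset.coe_insert] at h
    have cross : a i * ∑ j ∈ s, a j + (∑ j ∈ s, a j) * a i = 0 := by
      rw [Finset.mul_sum, Finset.sum_mul, ← Finset.sum_add_distrib]
      exact Finset.sum_eq_zero fun j hj =>
        h (Set.mem_insert i _) (Set.mem_insert_of_mem i hj) (ne_of_mem_of_not_mem hj hi).symm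
    calc (∑ j ∈ insert i s, a j) * ∑ j ∈ insert i s, a j
        = a i * a i + (a i * ∑ j ∈ s, a j + (∑ j ∈ s, a j) * a i) +
            (∑ j ∈ s, a j) * ∑ j ∈ s, a j := by
          rw [Finset.sum_insert hi, add_mul, mul_add, mul_add]
          abel
      _ = ∑ j ∈ insert i s, a j * a j := by
          rw [cross, add_zero, ih (h.mono (Set.subset_insert _ _)), Finset.sum_insert hi]

theorem card_le_rank_mul_card_of_coloring {V α K : Type*} [Fintype V] [Fintype α] [Field K]
    {M : Matrix V V K} (χ : V → α) (hdiag : ∀ u, M u u ≠ 0)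
    (hoff : ∀ u w, u ≠ w → χ u = χ w → M u w = 0) :
    Fintype.card V ≤ M.rank * Fintype.card α := by
  classical
  refine Finset.card_le_mul_card_image_of_maps_to (f := χ) (fun _ _ => Finset.mem_univ _) _
    fun a _ => ?_
  have hblock : M.submatrix (Subtype.val : {u // χ u = a} → V) Subtype.val =
      Matrix.diagonal fun u : {u // χ u = a} => M u u := by
    ext u w
    rcases eq_or_ne u w with rfl | huw
    · simp
    · rw [Matrix.submatrix_apply, Matrix.diagonal_apply_ne _ huw]
      exact hoff u w (Subtype.val_injective.ne huw) (u.2.trans w.2.symm)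
  calc Finset.card {u | χ u = a} = Fintype.card {u // χ u = a} := (Fintype.card_subtype _).symm
    _ = (M.submatrix (Subtype.val : {u // χ u = a} → V) Subtype.val).rank := by
        rw [hblock, Matrix.rank_diagonal]
        exact (Fintype.card_congr (Equiv.subtypeUnivEquiv (p := fun u : {u // χ u = a} => M u u ≠ 0)
          fun u => hdiag u)).symm
    _ ≤ M.rank := Matrix.rank_submatrix_le _ _ _

theorem isUnit_map_of_mul_eq_smul_one {R S ι : Type*} [CommRing R] [CommRing S] [Fintype ι]
    [DecidableEq ι] {M B : Matrix ι ι R} {r : R} (hMB : M * B = r • 1) {φ : R →+* S}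
    (hr : IsUnit (φ r)) : IsUnit (M.map φ) := by
  have hdet : φ M.det * φ B.det = φ r ^ Fintype.card ι := by
    rw [← map_mul, ← Matrix.det_mul, hMB, Matrix.det_smul, Matrix.det_one, mul_one, map_pow]
  rw [Matrix.isUnit_iff_isUnit_det, ← RingHom.mapMatrix_apply, ← RingHom.map_det]
  exact isUnit_of_mul_isUnit_left (hdet ▸ hr.pow _)

theorem monotone_apply_iff_card_filter_not_le {n : ℕ} {p : Fin n → Prop} [DecidablePred p]
    (hp : Monotone p) (k : Fin n) : p k ↔ Finset.card {i | ¬ p i} ≤ (k : ℕ) := by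
  constructor
  · intro hk
    rw [← Fin.card_Iio]
    refine Finset.card_le_card fun i hi => Finset.mem_Iio.2 ?_
    by_contra! hki
    exact (Finset.mem_filter.1 hi).2 (hp hki hk)
  · contrapose!
    intro hk
    have hsub : Finset.Iic k ⊆ ({i | ¬ p i} : Finset (Fin n)) := fun i hi =>
      Finset.mem_filter.2 ⟨Finset.mem_univ i, fun hpi => hk (hp (Finset.mem_Iic.1 hi) hpi)⟩
    simpa only [Fin.card_Iic, Nat.succ_le_iff] using Finset.card_le_card hsub

theorem degree_ne_zero_of_eval₂_eq_zero {R S : Type*} [Semiring R] [Semiring S] {φ : R →+* S}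
    {a : S} {p : R[X]} (hp : p.map φ ≠ 0) (ha : p.eval₂ φ a = 0) : p.degree ≠ 0 :=
  ((degree_pos_of_root hp (by rwa [IsRoot.def, eval_map])).trans_le degree_map_le).ne'

end General

section SmithNormalForm

theorem rank_map_eq_card_of_mul_mul_eq_diagonal {R K ι κ : Type*} [CommRing R] [Field K]
    [DecidableEq K] [Fintype ι] [DecidableEq ι] [Fintype κ] {M : Matrix ι ι R}
    {P Q : Matrix.GeneralLinearGroup ι R} {e : ι ≃ κ} {f : κ → R}
    (h : (P : Matrix ι ι R) * M * (Q : Matrix ι ι R) = Matrix.diagonal fun i => f (e i))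
    (φ : R →+* K) : (M.map φ).rank = Finset.card {i | φ (f i) ≠ 0} := by
  have hmap : P.1.map φ * M.map φ * Q.1.map φ = Matrix.diagonal fun i => φ (f (e i)) := by
    rw [← Matrix.map_mul, ← Matrix.map_mul, h, Matrix.diagonal_map (map_zero φ)]
  have hdet (U : Matrix.GeneralLinearGroup ι R) : IsUnit (U.1.map φ).det :=
    (Matrix.isUnit_iff_isUnit_det _).1 (U.isUnit.map φ.mapMatrix)
  rw [← Matrix.rank_mul_eq_right_of_isUnit_det _ (M.map φ) (hdet P),
    ← Matrix.rank_mul_eq_left_of_isUnit_det _ (P.1.map φ * M.map φ) (hdet Q), hmap,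
    Matrix.rank_diagonal, ← Fintype.card_subtype]
  exact Fintype.card_congr (e.subtypeEquiv fun _ => Iff.rfl)

theorem map_eq_zero_iff_rank_map_le {R K ι : Type*} [CommRing R] [Field K] [Fintype ι]
    [DecidableEq ι] {n : ℕ} {M : Matrix ι ι R} {P Q : Matrix.GeneralLinearGroup ι R}
    {e : ι ≃ Fin n} {f : Fin n → R} (hf : ∀ i j, i ≤ j → f i ∣ f j)
    (h : (P : Matrix ι ι R) * M * (Q : Matrix ι ι R) = Matrix.diagonal fun i => f (e i))
    (φ : R →+* K) (k : Fin n) : φ (f k) = 0 ↔ (M.map φ).rank ≤ k := by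
  classical
  rw [rank_map_eq_card_of_mul_mul_eq_diagonal h φ]
  exact monotone_apply_iff_card_filter_not_le (p := fun i => φ (f i) = 0)
    (fun i j hij hi => zero_dvd_iff.1 (hi ▸ map_dvd φ (hf i j hij))) k

theorem HasSmithNormalForm.exists_rank_map_eval₂_le {R k F K ι : Type*} [CommRing R] [Field k]
    [Field F] [Field K] [IsAlgClosed K] [Fintype ι] [DecidableEq ι] {M : Matrix ι ι R[X]}
    (hM : HasSmithNormalForm M) {φ : R →+* k} {a : k} {θ : k[X] →+* F}
    (hrank : (M.map (eval₂RingHom φ a)).rank < (M.map (θ.comp (mapRingHom φ))).rank)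
    {ψ : R →+* K} (hψ : Function.Injective ψ) :
    ∃ b : K, (M.map (eval₂RingHom ψ b)).rank ≤ (M.map (eval₂RingHom φ a)).rank := by
  obtain ⟨P, Q, e, f, hf, h⟩ := hM
  let r : Fin (Fintype.card ι) := ⟨_, hrank.trans_le (Matrix.rank_le_card_width _)⟩
  have hroot : (f r).eval₂ φ a = 0 :=
    (map_eq_zero_iff_rank_map_le hf h (eval₂RingHom φ a) r).2 le_rfl
  have hne : (f r).map φ ≠ 0 := fun h0 => hrank.not_ge <|
    (map_eq_zero_iff_rank_map_le hf h (θ.comp (mapRingHom φ)) r).1 <| by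
      rw [RingHom.comp_apply, coe_mapRingHom, h0, map_zero]
  obtain ⟨b, hb⟩ := IsAlgClosed.exists_eval₂_eq_zero_of_injective ψ hψ (f r)
    (degree_ne_zero_of_eval₂_eq_zero hne hroot)
  exact ⟨b, (map_eq_zero_iff_rank_map_le hf h (eval₂RingHom ψ b) r).1 hb⟩

end SmithNormalForm

namespace SignedColoredGraph

variable {N : ℕ} {V : Type*} {S : SignedColoredGraph N V} {c d : Fin N} {u w : V}

/-- The vertices `u` and `w` are joined by an edge of color `c`. -/
def ColorAdj (S : SignedColoredGraph N V) (c : Fin N) (u w : V) : Prop :=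
  ∃ h : S.graph.Adj u w, S.color ⟨s(u, w), h⟩ = c

theorem ColorAdj.adj (h : S.ColorAdj c u w) : S.graph.Adj u w := h.1

theorem ColorAdj.symm (h : S.ColorAdj c u w) : S.ColorAdj c w u := by
  obtain ⟨hadj, hc⟩ := h
  refine ⟨hadj.symm, ?_⟩
  rwa [show (⟨s(w, u), hadj.symm⟩ : S.graph.edgeSet) = ⟨s(u, w), hadj⟩ from
    Subtype.ext Sym2.eq_swap]

theorem ColorAdj.color_unique (hc : S.ColorAdj c u w) (hd : S.ColorAdj d u w) : c = d :=
  hc.2.symm.trans hd.2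

theorem exists_colorAdj_of_adj (h : S.graph.Adj u w) : ∃ c, S.ColorAdj c u w := ⟨_, h, rfl⟩

theorem bicolored_adj_iff : (S.bicolored c d).Adj u w ↔ S.ColorAdj c u w ∨ S.ColorAdj d u w :=
  exists_or

end SignedColoredGraph

theorem cycleGraph_four_exists_opposite : ∀ a b c : Fin 4, b ≠ c →
    (SimpleGraph.cycleGraph 4).Adj a b → (SimpleGraph.cycleGraph 4).Adj a c →
    ∃ z, z ≠ a ∧ (SimpleGraph.cycleGraph 4).Adj b z ∧ (SimpleGraph.cycleGraph 4).Adj c z := by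
  decide

theorem exists_opposite_of_iso_cycleGraph_four {V : Type*} {G : SimpleGraph V} {u v w : V}
    (φ : (G.connectedComponentMk u).toSimpleGraph ≃g SimpleGraph.cycleGraph 4)
    (hv : G.Adj u v) (hw : G.Adj u w) (hvw : v ≠ w) : ∃ z, z ≠ u ∧ G.Adj v z ∧ G.Adj w z := by
  let K := G.connectedComponentMk u
  let u' : K := ⟨u, rfl⟩
  let v' : K := ⟨v, SimpleGraph.ConnectedComponent.sound hv.symm.reachable⟩
  let w' : K := ⟨w, SimpleGraph.ConnectedComponent.sound hw.symm.reachable⟩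
  obtain ⟨z, hz, hvz, hwz⟩ := cycleGraph_four_exists_opposite (φ u') (φ v') (φ w')
    (fun h => hvw (congrArg Subtype.val (φ.injective h))) (φ.map_adj_iff.2 hv)
    (φ.map_adj_iff.2 hw)
  obtain ⟨z, rfl⟩ := φ.surjective z
  exact ⟨z, fun h => hz (congrArg φ (Subtype.ext h)), φ.map_adj_iff.1 hvz, φ.map_adj_iff.1 hwz⟩

namespace Adinkra

open SignedColoredGraph

section Neighbor

variable {N : ℕ} {V : Type*} (A : Adinkra N V) {d e : Fin N} {u w : V}

theorem exists_colorAdj (d : Fin N) (u : V) : ∃ w, A.ColorAdj d u w := by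
  obtain ⟨⟨_, he⟩, ⟨hu, hc⟩, -⟩ := A.existsUnique_edge u d
  obtain ⟨w, rfl⟩ := Sym2.mem_iff_exists.1 hu
  exact ⟨w, he, hc⟩

/-- The neighbor of `u` along the edge of color `d`. -/
noncomputable def neighbor (d : Fin N) (u : V) : V :=
  (A.exists_colorAdj d u).choose

theorem colorAdj_neighbor (d : Fin N) (u : V) : A.ColorAdj d u (A.neighbor d u) :=
  (A.exists_colorAdj d u).choose_spec

variable {A}

theorem colorAdj_iff : A.ColorAdj d u w ↔ w = A.neighbor d u := by
  refine ⟨fun h => ?_, fun h => h ▸ A.colorAdj_neighbor d u⟩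
  have hedge := (A.existsUnique_edge u d).unique
    ⟨Sym2.mem_mk_left u w, h.2⟩ ⟨Sym2.mem_mk_left u _, (A.colorAdj_neighbor d u).2⟩
  exact Sym2.congr_right.1 (congrArg Subtype.val hedge)

variable (A)

theorem neighbor_neighbor (d : Fin N) (u : V) : A.neighbor d (A.neighbor d u) = u :=
  (colorAdj_iff.1 (A.colorAdj_neighbor d u).symm).symm

theorem neighbor_injective (u : V) : Function.Injective fun d => A.neighbor d u :=
  fun d _ h => (A.colorAdj_neighbor d u).color_unique (colorAdj_iff.2 h)

theorem degree_eq (u : V) [Fintype (A.graph.neighborSet u)] : A.graph.degree u = N := by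
  let toNeighbor (d : Fin N) : A.graph.neighborSet u :=
    ⟨A.neighbor d u, (A.colorAdj_neighbor d u).adj⟩
  have hbij : Function.Bijective toNeighbor := by
    refine ⟨fun d e h => A.neighbor_injective u (congrArg Subtype.val h), fun ⟨w, hw⟩ => ?_⟩
    obtain ⟨d, hd⟩ := exists_colorAdj_of_adj hw
    exact ⟨d, Subtype.ext (colorAdj_iff.1 hd).symm⟩
  rw [← SimpleGraph.card_neighborSet_eq_degree, ← Fintype.card_of_bijective hbij,
    Fintype.card_fin]

theorem neighbor_comm (hde : d ≠ e) (u : V) :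
    A.neighbor d (A.neighbor e u) = A.neighbor e (A.neighbor d u) := by
  obtain ⟨φ⟩ := A.bicolored_component d e hde ((A.bicolored d e).connectedComponentMk u)
  obtain ⟨z, hzu, hdz, hez⟩ := exists_opposite_of_iso_cycleGraph_four φ
    (bicolored_adj_iff.2 (.inl (A.colorAdj_neighbor d u)))
    (bicolored_adj_iff.2 (.inr (A.colorAdj_neighbor e u))) ((A.neighbor_injective u).ne hde)
  simp only [bicolored_adj_iff, colorAdj_iff, neighbor_neighbor, hzu, false_or, or_false]
    at hdz hez
  exact hez.symm.trans hdz

end Neighbor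

section Signs

variable {N : ℕ} {V : Type*} {A : Adinkra N V} {d e : Fin N} {u w w' z : V}

theorem signedAdjMatrix_of_adj (h : A.graph.Adj u w) :
    A.signedAdjMatrix u w = A.sign ⟨s(u, w), h⟩ := by
  simp only [signedAdjMatrix, Matrix.of_apply, dif_pos h]

theorem signedAdjMatrix_of_not_adj (h : ¬ A.graph.Adj u w) : A.signedAdjMatrix u w = 0 := by
  simp only [signedAdjMatrix, Matrix.of_apply, dif_neg h]

theorem signedAdjMatrix_comm (u w : V) : A.signedAdjMatrix u w = A.signedAdjMatrix w u := by
  by_cases h : A.graph.Adj u w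
  · rw [signedAdjMatrix_of_adj h, signedAdjMatrix_of_adj h.symm]
    congr 2
    exact Subtype.ext Sym2.eq_swap
  · rw [signedAdjMatrix_of_not_adj h, signedAdjMatrix_of_not_adj (mt SimpleGraph.Adj.symm h)]

theorem signedAdjMatrix_mul_self (h : A.graph.Adj u w) :
    A.signedAdjMatrix u w * A.signedAdjMatrix u w = 1 := by
  rw [signedAdjMatrix_of_adj h, ← Units.val_mul, Int.units_mul_self, Units.val_one]

theorem units_mul_eq_neg_mul_of_odd_count :
    ∀ a b c d : ℤˣ, Odd ([a, b, c, d].count (-1)) → (a * b : ℤ) = -(d * c : ℤ) := by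
  decide

theorem signedAdjMatrix_mul_of_square (hde : d ≠ e) (huw : A.ColorAdj d u w)
    (hwz : A.ColorAdj e w z) (huw' : A.ColorAdj e u w') (hwz' : A.ColorAdj d w' z) :
    A.signedAdjMatrix u w * A.signedAdjMatrix w z =
      -(A.signedAdjMatrix u w' * A.signedAdjMatrix w' z) := by
  have huz : u ≠ z := by
    rintro rfl
    exact hde (huw.symm.color_unique hwz)
  have hww' : w ≠ w' := by
    rintro rfl
    exact hde (huw.color_unique huw')
  rw [signedAdjMatrix_comm u w', signedAdjMatrix_comm w' z, signedAdjMatrix_of_adj huw.adj,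
    signedAdjMatrix_of_adj hwz.adj, signedAdjMatrix_of_adj huw'.symm.adj,
    signedAdjMatrix_of_adj hwz'.symm.adj]
  exact units_mul_eq_neg_mul_of_odd_count _ _ _ _ <| A.odd_negative d e hde u w z w' huz hww'
    (bicolored_adj_iff.2 (.inl huw)) (bicolored_adj_iff.2 (.inr hwz))
    (bicolored_adj_iff.2 (.inl hwz'.symm)) (bicolored_adj_iff.2 (.inr huw'.symm))

end Signs

section Clifford

variable {N : ℕ} {V : Type*} [DecidableEq V] (A : Adinkra N V) {d e : Fin N} {u w : V}

/-- The part of the signed adjacency matrix supported on the edges of color `d`. These signed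
permutation matrices satisfy the relations of the Clifford algebra with `N` generators. -/
noncomputable def colorMatrix (d : Fin N) : Matrix V V ℤ :=
  Matrix.of fun u w => if w = A.neighbor d u then A.signedAdjMatrix u w else 0

variable {A}

theorem colorMatrix_of_colorAdj (h : A.ColorAdj d u w) :
    A.colorMatrix d u w = A.signedAdjMatrix u w :=
  if_pos (colorAdj_iff.1 h)

theorem colorMatrix_of_not_colorAdj (h : ¬ A.ColorAdj d u w) : A.colorMatrix d u w = 0 :=
  if_neg (mt colorAdj_iff.2 h)

variable (A) [Fintype V]

theorem colorMatrix_mul_apply (d : Fin N) (M : Matrix V V ℤ) (u w : V) :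
    (A.colorMatrix d * M) u w =
      A.signedAdjMatrix u (A.neighbor d u) * M (A.neighbor d u) w := by
  simp only [Matrix.mul_apply, colorMatrix, Matrix.of_apply, ite_mul, zero_mul,
    Finset.sum_ite_eq', Finset.mem_univ, if_true]

theorem colorMatrix_mul_self (d : Fin N) : A.colorMatrix d * A.colorMatrix d = 1 := by
  ext u w
  have hu := A.colorAdj_neighbor d u
  rw [colorMatrix_mul_apply]
  rcases eq_or_ne u w with rfl | huw
  · rw [colorMatrix_of_colorAdj hu.symm, signedAdjMatrix_comm (A.neighbor d u),
      signedAdjMatrix_mul_self hu.adj, Matrix.one_apply_eq]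
  · have hw : ¬ A.ColorAdj d (A.neighbor d u) w := by
      rw [colorAdj_iff, neighbor_neighbor]
      exact huw.symm
    rw [colorMatrix_of_not_colorAdj hw, mul_zero, Matrix.one_apply_ne huw]

theorem colorMatrix_anticomm (hde : d ≠ e) :
    A.colorMatrix d * A.colorMatrix e + A.colorMatrix e * A.colorMatrix d = 0 := by
  ext u w
  rw [Matrix.add_apply, colorMatrix_mul_apply, colorMatrix_mul_apply, Matrix.zero_apply]
  by_cases hw : A.ColorAdj e (A.neighbor d u) w
  · have hw' : A.ColorAdj d (A.neighbor e u) w := by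
      rwa [colorAdj_iff, A.neighbor_comm hde, ← colorAdj_iff]
    rw [colorMatrix_of_colorAdj hw, colorMatrix_of_colorAdj hw',
      signedAdjMatrix_mul_of_square hde (A.colorAdj_neighbor d u) hw
        (A.colorAdj_neighbor e u) hw', neg_add_cancel]
  · have hw' : ¬ A.ColorAdj d (A.neighbor e u) w := by
      rwa [colorAdj_iff, A.neighbor_comm hde, ← colorAdj_iff]
    rw [colorMatrix_of_not_colorAdj hw, colorMatrix_of_not_colorAdj hw', mul_zero, mul_zero,
      add_zero]

/-- The signed adjacency matrix with the entries at the edges of color `c` multiplied by `x`: up to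
sign, the off-diagonal part of the deformed Laplacian. -/
noncomputable def deformedAdjMatrix (c : Fin N) : Matrix V V ℤ[X] :=
  ∑ d, (if d = c then X else 1 : ℤ[X]) • (A.colorMatrix d).map C

theorem deformedAdjMatrix_mul_self (c : Fin N) :
    A.deformedAdjMatrix c * A.deformedAdjMatrix c = (X ^ 2 + ((N : ℤ[X]) - 1)) • 1 := by
  have hself (d : Fin N) : (A.colorMatrix d).map C * (A.colorMatrix d).map C = 1 := by
    rw [← Matrix.map_mul, A.colorMatrix_mul_self, Matrix.map_one C C_0 C_1]
  have hanti (d e : Fin N) (hde : d ≠ e) :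
      (A.colorMatrix d).map C * (A.colorMatrix e).map C +
        (A.colorMatrix e).map C * (A.colorMatrix d).map C = 0 := by
    rw [← Matrix.map_mul, ← Matrix.map_mul, ← Matrix.map_add C fun _ _ => C_add,
      A.colorMatrix_anticomm hde, Matrix.map_zero C C_0]
  have hsum : ∑ d : Fin N, (if d = c then X else 1 : ℤ[X]) * (if d = c then X else 1) =
      X ^ 2 + ((N : ℤ[X]) - 1) := by
    rw [← Finset.add_sum_erase _ _ (Finset.mem_univ c), if_pos rfl, ← sq,
      Finset.sum_congr rfl fun d hd => by rw [if_neg (Finset.ne_of_mem_erase hd), one_mul],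
      Finset.sum_const, Finset.card_erase_of_mem (Finset.mem_univ c), Finset.card_fin, nsmul_one,
      Nat.cast_pred c.pos]
  rw [deformedAdjMatrix, sum_mul_self_of_pairwise_anticomm]
  · simp only [smul_mul_smul_comm, hself, ← Finset.sum_smul, hsum]
  · intro d _ e _ hde
    rw [smul_mul_smul_comm, smul_mul_smul_comm, mul_comm (ite (e = c) _ _), ← smul_add,
      hanti d e hde, smul_zero]

end Clifford

section Laplacian

variable {N : ℕ} {V : Type*} [DecidableEq V] {A : Adinkra N V} {c d : Fin N} {u w : V}

theorem deformedAdjMatrix_of_colorAdj (h : A.ColorAdj d u w) :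
    A.deformedAdjMatrix c u w = (if d = c then X else 1) * C (A.signedAdjMatrix u w) := by
  rw [deformedAdjMatrix, Matrix.sum_apply, Finset.sum_eq_single d]
  · rw [Matrix.smul_apply, Matrix.map_apply, colorMatrix_of_colorAdj h, smul_eq_mul]
  · intro e _ hed
    rw [Matrix.smul_apply, Matrix.map_apply,
      colorMatrix_of_not_colorAdj fun he => hed (he.color_unique h), C_0, smul_zero]
  · exact fun hd => absurd (Finset.mem_univ d) hd

theorem deformedAdjMatrix_of_not_adj (h : ¬ A.graph.Adj u w) :
    A.deformedAdjMatrix c u w = 0 := by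
  rw [deformedAdjMatrix, Matrix.sum_apply]
  refine Finset.sum_eq_zero fun d _ => ?_
  rw [Matrix.smul_apply, Matrix.map_apply,
    colorMatrix_of_not_colorAdj fun hd => h hd.adj, C_0, smul_zero]

variable [Fintype V]

theorem laplacian_apply_self (A : Adinkra N V) (u : V) : A.laplacian u u = N := by
  rw [laplacian, Matrix.sub_apply, Matrix.diagonal_apply_eq, A.degree_eq,
    signedAdjMatrix_of_not_adj A.graph.irrefl, sub_zero]

theorem laplacian_apply_of_ne (h : u ≠ w) : A.laplacian u w = -A.signedAdjMatrix u w := by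
  rw [laplacian, Matrix.sub_apply, Matrix.diagonal_apply_ne _ h, zero_sub]

theorem deformedLaplacian_eq (A : Adinkra N V) (c : Fin N) :
    A.deformedLaplacian c = (X + ((N : ℤ[X]) - 1)) • 1 - A.deformedAdjMatrix c := by
  ext1 u w
  rw [deformedLaplacian, Matrix.of_apply, Matrix.sub_apply, Matrix.smul_apply, smul_eq_mul]
  rcases eq_or_ne u w with rfl | huw
  · rw [if_pos rfl, Matrix.one_apply_eq, deformedAdjMatrix_of_not_adj A.graph.irrefl, mul_one,
      sub_zero]
  rw [if_neg huw, Matrix.one_apply_ne huw, mul_zero, zero_sub, laplacian_apply_of_ne huw, C_neg]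
  by_cases hadj : A.graph.Adj u w
  · obtain ⟨d, hd⟩ := exists_colorAdj_of_adj hadj
    have hc : (∃ h : A.graph.Adj u w, A.color ⟨s(u, w), h⟩ = c) ↔ d = c :=
      ⟨hd.color_unique, fun h => h ▸ hd⟩
    rw [deformedAdjMatrix_of_colorAdj hd]
    simp only [hc]
    split_ifs <;> ring
  · rw [deformedAdjMatrix_of_not_adj hadj, signedAdjMatrix_of_not_adj hadj]
    simp only [C_0, neg_zero, zero_mul, ite_self]

theorem deformedLaplacian_mul_add_deformedAdjMatrix (A : Adinkra N V) (c : Fin N) :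
    A.deformedLaplacian c * ((X + ((N : ℤ[X]) - 1)) • 1 + A.deformedAdjMatrix c) =
      (((N : ℤ[X]) - 1) * (2 * X + ((N : ℤ[X]) - 2))) • 1 := by
  rw [deformedLaplacian_eq, sub_mul, mul_add, mul_add, A.deformedAdjMatrix_mul_self]
  simp only [smul_mul_assoc, mul_smul_comm, one_mul, mul_one, smul_smul]
  module

theorem rank_deformedLaplacian_map_of_root {K : Type*} [Field K] [CharZero K] {φ : ℤ[X] →+* K}
    (hφ : φ (X + ((N : ℤ[X]) - 1)) = 0) :
    ((A.deformedLaplacian c).map φ).rank = Fintype.card V := by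
  have hX : φ X = 1 - N := by
    rw [map_add, map_sub, map_natCast, map_one] at hφ
    linear_combination hφ
  have hval : φ (((N : ℤ[X]) - 1) * (2 * X + ((N : ℤ[X]) - 2))) = -(N * (N - 1)) := by
    simp only [map_mul, map_add, map_sub, map_natCast, map_one, map_ofNat, hX]
    ring
  have hN0 : (N : K) ≠ 0 := Nat.cast_ne_zero.2 c.pos.ne'
  have hN1 : (N : K) ≠ 1 := Nat.cast_ne_one.2 (one_lt_two.trans_le A.two_le).ne'
  refine Matrix.rank_of_isUnit _
    (isUnit_map_of_mul_eq_smul_one (A.deformedLaplacian_mul_add_deformedAdjMatrix c) ?_)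
  rw [hval]
  exact (neg_ne_zero.2 (mul_ne_zero hN0 (sub_ne_zero.2 hN1))).isUnit

theorem card_le_rank_deformedLaplacian_map_mul_two_of_ne_zero {K : Type*} [Field K]
    {φ : ℤ[X] →+* K} (hφ : φ (X + ((N : ℤ[X]) - 1)) ≠ 0) :
    Fintype.card V ≤ ((A.deformedLaplacian c).map φ).rank * 2 := by
  obtain ⟨χ⟩ := A.bipartite
  rw [← Fintype.card_fin 2]
  refine card_le_rank_mul_card_of_coloring χ (fun u => ?_) fun u w huw hχ => ?_
  · rwa [Matrix.map_apply, deformedLaplacian_eq, Matrix.sub_apply, Matrix.smul_apply,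
      Matrix.one_apply_eq, deformedAdjMatrix_of_not_adj A.graph.irrefl, smul_eq_mul, mul_one,
      sub_zero]
  · rw [Matrix.map_apply, deformedLaplacian_eq, Matrix.sub_apply, Matrix.smul_apply,
      Matrix.one_apply_ne huw, deformedAdjMatrix_of_not_adj fun h => χ.valid h hχ, smul_zero,
      sub_zero, map_zero]

theorem card_le_rank_deformedLaplacian_map_mul_two {K : Type*} [Field K] [CharZero K]
    (A : Adinkra N V) (c : Fin N) (φ : ℤ[X] →+* K) :
    Fintype.card V ≤ ((A.deformedLaplacian c).map φ).rank * 2 := by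
  by_cases hφ : φ (X + ((N : ℤ[X]) - 1)) = 0
  · rw [rank_deformedLaplacian_map_of_root hφ]
    exact Nat.le_mul_of_pos_right _ two_pos
  · exact card_le_rank_deformedLaplacian_map_mul_two_of_ne_zero hφ

theorem card_le_rank_deformedLaplacian_map_ratFunc_mul_two (A : Adinkra N V) (c : Fin N)
    (k : Type*) [Field k] :
    Fintype.card V ≤ ((A.deformedLaplacian c).map
      ((algebraMap k[X] (RatFunc k)).comp (mapRingHom (Int.castRingHom k)))).rank * 2 := by
  apply card_le_rank_deformedLaplacian_map_mul_two_of_ne_zero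
  have hmap : mapRingHom (Int.castRingHom k) (X + ((N : ℤ[X]) - 1)) = X + C ((N : k) - 1) := by
    simp
  rw [RingHom.comp_apply, hmap]
  exact RatFunc.algebraMap_ne_zero (X_add_C_ne_zero _)

theorem deformedLaplacian_map_eval_one (A : Adinkra N V) (c : Fin N) :
    (A.deformedLaplacian c).map (eval 1) = A.laplacian := by
  ext u w
  rw [Matrix.map_apply, deformedLaplacian, Matrix.of_apply]
  split_ifs with huw
  · subst huw
    simp [laplacian_apply_self]
  · rw [eval_mul_X, eval_C, mul_one]
  · rw [eval_C]

open scoped Classical in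
theorem laplacian_map_intCast_zmod_two (A : Adinkra N V) :
    A.laplacian.map (Int.cast : ℤ → ZMod 2) = A.graph.lapMatrix (ZMod 2) := by
  have hsign (ε : ℤˣ) : ((ε : ℤ) : ZMod 2) = 1 := by
    rcases Int.units_eq_one_or ε with rfl | rfl <;> rfl
  have hadj : A.signedAdjMatrix.map (Int.cast : ℤ → ZMod 2) = A.graph.adjMatrix (ZMod 2) := by
    ext u w
    rw [Matrix.map_apply, SimpleGraph.adjMatrix_apply]
    split_ifs with h
    · rw [signedAdjMatrix_of_adj h, hsign]
    · rw [signedAdjMatrix_of_not_adj h, Int.cast_zero]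
  rw [laplacian, Matrix.map_sub _ Int.cast_sub, Matrix.diagonal_map Int.cast_zero, hadj,
    SimpleGraph.lapMatrix, SimpleGraph.degMatrix]
  simp only [Int.cast_natCast]

theorem rank_deformedLaplacian_map_eval₂_one (A : Adinkra N V) (c : Fin N) :
    ((A.deformedLaplacian c).map (eval₂RingHom (Int.castRingHom (ZMod 2)) 1)).rank =
      A.twoRank := by
  classical
  rw [twoRank, ← laplacian_map_intCast_zmod_two, ← A.deformedLaplacian_map_eval_one c,
    Matrix.map_map]
  congr 2
  funext p
  exact eval₂_at_one _

theorem IsNonGeneric.twoRank_mul_two_lt (hA : A.IsNonGeneric) :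
    A.twoRank * 2 < Fintype.card V := by
  rw [IsNonGeneric, twoRankDefect, sub_pos, lt_div_iff₀ two_pos] at hA
  exact_mod_cast hA

end Laplacian

end Adinkra

theorem proposition4p1 {N : ℕ} {V : Type*} [Fintype V] [DecidableEq V]
    (A : Adinkra N V) (hA : A.IsNonGeneric) (c : Fin N) :
    ¬ HasSmithNormalForm (A.deformedLaplacian c) := by
  intro hsmith
  have hsmall := hA.twoRank_mul_two_lt
  have hspecial := A.rank_deformedLaplacian_map_eval₂_one c
  have hgeneric := A.card_le_rank_deformedLaplacian_map_ratFunc_mul_two c (ZMod 2)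
  obtain ⟨b, hb⟩ := hsmith.exists_rank_map_eval₂_le
    (lt_of_mul_lt_mul_right' (hspecial ▸ hsmall.trans_le hgeneric))
    (RingHom.injective_int (Int.castRingHom ℂ))
  have hcomplex := A.card_le_rank_deformedLaplacian_map_mul_two c
    (eval₂RingHom (Int.castRingHom ℂ) b)
  omega
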